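/- **Maps.** A $C^r$ generalized interval exchange transformation with gaps (g-GIET) on $d$ intervals is a map $S:I^t\to I^b$, where $I^t=\bigsqcup_{\alpha\in\mathcal A}I^t_\alpha$ and $I^b=\bigsqcup_{\alpha\in\mathcal A}I^b_\alpha$ are disjoint unions of $d=|\mathcal A|$ non-empty right-open subintervals of $[0,1)$ (top and bottom intervals) and each $S|_{I^t_\alpha}$ is an orientation preserving bijection onto $I^b_\alpha$ that extends to a $C^r$-diffeomorphism between the closures. The complements of $I^t$, $I^b$ form the top and bottom gaps. If $I^t=I^b=[0,1)$, $S$ is a GIET. **Orbits.** Let $T$ be a GIET and $R\subset[0,1)$ a finite union of right-open intervals; $T|_R:R\to T(R)$ is a partially defined map. The orbit of $x\in R$ under $T|_R$ consists of all forward and backward iterates of $x$ that are defined. It is *regular* if it is contained in $R\cap T(R)$, *periodic* if it is regular and finite, *transient* if it leaves $R$ in the future and $T(R)$ in the past, and *non-trivially recurrent* if it is regular and each of its points is an accumulation point both of its forward and of its backward orbit. *Recurrent* means periodic or non-trivially recurrent. A *quasiminimal* is the closure in $R$ of a non-trivially recurrent orbit. $R$ is a *domain of recurrence* if no orbit of $T|_R$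 is transient. A domain of recurrence $R$ is - a *periodic domain* if $T|_R$ has a periodic orbit, possibly at an endpoint (that is, $T|_R$, or its left-open version obtained by extending the branches continuously to the right endpoints of the intervals, has a periodic orbit), and all recurrent orbits of $T|_R$ are periodic of the same period; - a *quasiminimal domain* if $T|_R$ has a unique quasiminimal and all its recurrent orbits are non-trivially recurrent. **Rauzy–Veech induction.** Let $S$ be a g-GIET on $d\ge1$ intervals with rightmost top interval $I^t_{a}=[l^t,r^t)$ and rightmost bottom interval $I^b_{b}=[l^b,r^b)$. If $a=b$ and $r^t=r^b$, $S$ ends in a *cylinder* and no step is made. Otherwise one step replaces $S$ by its first return map to $[0,\lambda)$, with $\lambda=\max(l^t,l^b)$ if $r^t=r^b$ or if $\max(l^t,l^b)\ge\min(r^t,r^b)$, and $\lambda=\min(r^t,r^b)$ otherwise. Labels: - $r^t=r^b$, $l^t<l^b$: $a$ wins, $b$ loses; $I^t_a$ becomes $[l^t,l^b)$ and on $I^t_b$ the map becomes $S^2$. - $r^t=r^b$, $l^b<l^t$: $b$ wins, $a$ loses; $I^b_b$ becomes $[l^b,l^t)$, and the part of the old $I^t_b$ mapped to $[l^t,r^t)$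 gets the label $a$ and the map $S^2$. - $r^t=r^b$, $l^t=l^b$: nobody wins; $a$ is removed and on $I^t_b$ the map becomes $S^2$. - $r^t\ne r^b$, $\max(l^t,l^b)<\min(r^t,r^b)$: the interval ($I^t_a$ if $r^t>r^b$, $I^b_b$ if $r^b>r^t$) wins against a gap and is cut at $\lambda$. - $r^t\ne r^b$, $\max(l^t,l^b)\ge\min(r^t,r^b)$: the letter $a$ (if $r^t>r^b$), respectively $b$ (if $r^b>r^t$), loses against a gap and is removed. An iterate $S^{(N)}$ of an infinite sequence of steps is *RV-stable* if no letter is removed from step $N$ on, and each letter, from step $N$ on, wins never or infinitely often and loses never or infinitely often. **Decomposition.** The renormalization scheme applied to a g-GIET $S$ iterates the induction. If all intervals get removed, it ends without output. If some $S^{(n)}$ ends in a cylinder with label $a$, it outputs the restriction of $S^{(n)}$ to $I^t_a$ and restarts with the restriction of $S^{(n)}$ to the other intervals. If the induction never stops, one chooses $N$ with $S^{(N)}$ RV-stable, outputs the restriction of $S^{(N)}$ to the set of intervals whose letters win infinitely often, and restarts with the restriction to the other letters, unless the right endpoints of the rightmost top intervals of $S^{(n)}$ tend to $0$, in which case the scheme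 ends. Starting from a GIET $T$, let $T_i:E_i\to T_i(E_i)$, $1\le i\le k$, be the outputs. On each interval $I$ of $E_i$, $T_i$ is an iterate $T^{n_I}$, $n_I\ge1$, with $I,T(I),\dots,T^{n_I-1}(I)$ pairwise disjoint; let $R_i=\bigcup_{I}\bigcup_{0\le j<n_I}T^j(I)$ be the union of these towers. The sets $R_1,\dots,R_k$ are the domains of a decomposition of $T$ (the remaining part of $[0,1)$ being $D=[0,1)\setminus\bigcup_iR_i$). **Theorem.** Let $T:[0,1)\to[0,1)$ be a $C^r$ GIET with $d$ intervals. Then $T$ has a decomposition of this kind, and for every such decomposition, if $p$ denotes the number of its periodic domains and $q$ the number of its quasiminimal domains, then $$q\le\left\lfloor\frac{d-p}{2}\right\rfloor .$$ -/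

import Mathlib

open Set Filter Topology

/-! ### Partial dynamics

`F : ℝ → ℝ` and `J : Set ℝ` encode the partially defined map `F|_J : J → F '' J`; the complement of
`J` consists of the top gaps, the complement of `F '' J` of the bottom gaps. In all uses below `F` is
injective on `J`. -/

namespace PartialDyn

/-- Domain of definition of the `n`-th iterate of `F|_J` (everything for `n = 0`). -/
def iterDom (F : ℝ → ℝ) (J : Set ℝ) (n : ℕ) : Set ℝ :=
  {x | ∀ i < n, F^[i] x ∈ J}

/-- Forward orbit of `x`, including `x`. -/
def fwdOrbit (F : ℝ → ℝ) (J : Set ℝ) (x : ℝ) : Set ℝ :=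
  {y | ∃ n, x ∈ iterDom F J n ∧ F^[n] x = y}

/-- Backward orbit of `x`, including `x`. -/
def bwdOrbit (F : ℝ → ℝ) (J : Set ℝ) (x : ℝ) : Set ℝ :=
  {y | ∃ n, y ∈ iterDom F J n ∧ F^[n] y = x}

/-- Full orbit of `x`. -/
def orbit (F : ℝ → ℝ) (J : Set ℝ) (x : ℝ) : Set ℝ :=
  fwdOrbit F J x ∪ bwdOrbit F J x

/-- The orbit stays in the domain and in the image of `F|_J`. -/
def IsRegular (F : ℝ → ℝ) (J : Set ℝ) (x : ℝ) : Prop :=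
  orbit F J x ⊆ J ∩ F '' J

/-- Regular and finite orbit. -/
def IsPeriodic (F : ℝ → ℝ) (J : Set ℝ) (x : ℝ) : Prop :=
  IsRegular F J x ∧ (orbit F J x).Finite

/-- The orbit leaves the domain in the future through a top gap and in the past through a bottom
gap. -/
def IsTransient (F : ℝ → ℝ) (J : Set ℝ) (x : ℝ) : Prop :=
  (∃ y ∈ fwdOrbit F J x, y ∉ J) ∧ (∃ y ∈ bwdOrbit F J x, y ∉ F '' J)

/-- `J` contains no transient orbit of `F|_J`. -/
def IsDomainOfRecurrence (F : ℝ → ℝ) (J : Set ℝ) : Prop :=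
  ∀ x ∈ J, ¬ IsTransient F J x

/-- The orbit of `x` is a non-trivially recurrent orbit: it is regular, and each of its points is an
accumulation point of its own forward orbit and of its own backward orbit. -/
def IsNontriviallyRecurrent (F : ℝ → ℝ) (J : Set ℝ) (x : ℝ) : Prop :=
  IsRegular F J x ∧
    ∀ y ∈ orbit F J x, AccPt y (𝓟 (fwdOrbit F J y)) ∧ AccPt y (𝓟 (bwdOrbit F J y))

/-- Recurrent orbits are the periodic (trivially recurrent) and the non-trivially recurrent ones. -/
def IsRecurrent (F : ℝ → ℝ) (J : Set ℝ) (x : ℝ) : Prop :=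
  IsPeriodic F J x ∨ IsNontriviallyRecurrent F J x

/-- A quasiminimal: the closure in `J` of a non-trivially recurrent orbit. -/
def IsQuasiminimal (F : ℝ → ℝ) (J Ω : Set ℝ) : Prop :=
  ∃ x ∈ J, IsNontriviallyRecurrent F J x ∧ Ω = closure (orbit F J x) ∩ J

end PartialDyn

/-! ### Generalized interval exchange maps with gaps -/

/-- Data of an interval exchange map with gaps, labelled by a finite set `letters`: top intervals
`[tl α, tr α)`, bottom intervals `[bl α, br α)`, branches `f α` from top to bottom and inverse
branches `g α`. Only the values at `α ∈ letters`, and those of the branches on the closed intervals,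
are meaningful. -/
structure GapMap (ι : Type*) where
  letters : Finset ι
  tl : ι → ℝ
  tr : ι → ℝ
  bl : ι → ℝ
  br : ι → ℝ
  f : ι → ℝ → ℝ
  g : ι → ℝ → ℝ

namespace GapMap

variable {ι : Type*}

/-- The union `I^t` of the top intervals. -/
def topSet (S : GapMap ι) : Set ℝ := ⋃ α ∈ S.letters, Ico (S.tl α) (S.tr α)

/-- The union `I^b` of the bottom intervals. -/
def botSet (S : GapMap ι) : Set ℝ := ⋃ α ∈ S.letters, Ico (S.bl α) (S.br α)

/-- `S` is a `C^r` generalized interval exchange transformation with gaps: disjoint non-empty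
right-open intervals in `[0,1)`, and every branch is an orientation preserving `C^r`-diffeomorphism
between the closures of its top and its bottom interval. -/
structure IsGGIET (r : ℕ∞) (S : GapMap ι) : Prop where
  top_lt : ∀ α ∈ S.letters, S.tl α < S.tr α
  top_subset : ∀ α ∈ S.letters, Ico (S.tl α) (S.tr α) ⊆ Ico 0 1
  top_disjoint : ∀ α ∈ S.letters, ∀ β ∈ S.letters, α ≠ β →
    Disjoint (Ico (S.tl α) (S.tr α)) (Ico (S.tl β) (S.tr β))
  bot_lt : ∀ α ∈ S.letters, S.bl α < S.br α
  bot_subset : ∀ α ∈ S.letters, Ico (S.bl α) (S.br α) ⊆ Ico 0 1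
  bot_disjoint : ∀ α ∈ S.letters, ∀ β ∈ S.letters, α ≠ β →
    Disjoint (Ico (S.bl α) (S.br α)) (Ico (S.bl β) (S.br β))
  strictMonoOn : ∀ α ∈ S.letters, StrictMonoOn (S.f α) (Icc (S.tl α) (S.tr α))
  mapsTo : ∀ α ∈ S.letters,
    MapsTo (S.f α) (Icc (S.tl α) (S.tr α)) (Icc (S.bl α) (S.br α))
  mapsTo_inv : ∀ α ∈ S.letters,
    MapsTo (S.g α) (Icc (S.bl α) (S.br α)) (Icc (S.tl α) (S.tr α))
  invOn : ∀ α ∈ S.letters,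
    InvOn (S.g α) (S.f α) (Icc (S.tl α) (S.tr α)) (Icc (S.bl α) (S.br α))
  contDiffOn : ∀ α ∈ S.letters, ContDiffOn ℝ r (S.f α) (Icc (S.tl α) (S.tr α))
  contDiffOn_inv : ∀ α ∈ S.letters, ContDiffOn ℝ r (S.g α) (Icc (S.bl α) (S.br α))

/-- A generalized interval exchange transformation: no gaps. -/
structure IsGIET (r : ℕ∞) (S : GapMap ι) : Prop extends IsGGIET r S where
  topSet_eq : S.topSet = Ico 0 1
  botSet_eq : S.botSet = Ico 0 1

open Classical in
/-- The map `I^t → I^b`, extended by the identity outside `I^t`. -/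
noncomputable def toFun (S : GapMap ι) (x : ℝ) : ℝ :=
  if h : ∃ α ∈ S.letters, x ∈ Ico (S.tl α) (S.tr α) then S.f h.choose x else x

open Classical in
/-- The associated left-open map, defined on the intervals `(tl α, tr α]` through the continuous
extensions of the branches. -/
noncomputable def leftFun (S : GapMap ι) (x : ℝ) : ℝ :=
  if h : ∃ α ∈ S.letters, x ∈ Ioc (S.tl α) (S.tr α) then S.f h.choose x else x

/-- The restriction of `S` to the intervals with labels in `E`. -/
def restrict (S : GapMap ι) (E : Finset ι) : GapMap ι := { S with letters := E }

/-! ### Periodic and quasiminimal domains -/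

/-- For a finite disjoint union `R` of intervals `[c,d)`, the union of the intervals `(c,d]`. -/
def leftOpen (R : Set ℝ) : Set ℝ := {x | ∃ y < x, Ioo y x ⊆ R}

/-- `T|_R` has a periodic orbit, possibly at an endpoint: a periodic orbit of `T|_R`, or one of the
left-open map associated with `T|_R`. (A periodic orbit of the latter that meets no right endpoint
of an interval is also a periodic orbit of `T|_R`.) -/
def HasPeriodicOrbit (T : GapMap ι) (R : Set ℝ) : Prop :=
  (∃ x ∈ R, PartialDyn.IsPeriodic T.toFun R x) ∨
    ∃ x ∈ leftOpen R, PartialDyn.IsPeriodic T.leftFun (leftOpen R) x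

/-- `R` is a periodic domain of `T`: a domain of recurrence such that `T|_R` has a periodic orbit,
possibly at an endpoint, and all its recurrent orbits are periodic, of the same period. -/
def IsPeriodicDomain (T : GapMap ι) (R : Set ℝ) : Prop :=
  PartialDyn.IsDomainOfRecurrence T.toFun R ∧ T.HasPeriodicOrbit R ∧
    ∃ m : ℕ, ∀ x ∈ R, PartialDyn.IsRecurrent T.toFun R x →
      PartialDyn.IsPeriodic T.toFun R x ∧ (PartialDyn.orbit T.toFun R x).ncard = m

/-- `R` is a quasiminimal domain of `T`: a domain of recurrence such that `T|_R` has a unique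
quasiminimal and all its recurrent orbits are non-trivially recurrent. -/
def IsQuasiminimalDomain (T : GapMap ι) (R : Set ℝ) : Prop :=
  PartialDyn.IsDomainOfRecurrence T.toFun R ∧
    (∃! Ω : Set ℝ, PartialDyn.IsQuasiminimal T.toFun R Ω) ∧
    ∀ x ∈ R, PartialDyn.IsRecurrent T.toFun R x →
      PartialDyn.IsNontriviallyRecurrent T.toFun R x

/-! ### Rauzy–Veech induction with gaps -/

/-- `a` labels the rightmost top interval. -/
def IsTopLast (S : GapMap ι) (a : ι) : Prop :=
  a ∈ S.letters ∧ ∀ β ∈ S.letters, S.tr β ≤ S.tr a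

/-- `b` labels the rightmost bottom interval. -/
def IsBotLast (S : GapMap ι) (b : ι) : Prop :=
  b ∈ S.letters ∧ ∀ β ∈ S.letters, S.br β ≤ S.br b

variable [DecidableEq ι]

/-- First return map to `[0, bl b)` when the top interval `a` wins against the bottom interval `b`:
`a` keeps its part left of `bl b`, and on `b` the map becomes the second iterate. -/
def topWins (S : GapMap ι) (a b : ι) : GapMap ι where
  letters := S.letters
  tl := S.tl
  tr := Function.update S.tr a (S.bl b)
  bl := Function.update S.bl b (S.f a (S.bl b))
  br := Function.update (Function.update S.br b (S.br a)) a (S.f a (S.bl b))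
  f := Function.update S.f b (S.f a ∘ S.f b)
  g := Function.update S.g b (S.g b ∘ S.g a)

/-- First return map to `[0, tl a)` when the bottom interval `b` wins against the top interval `a`:
the top interval of `b` is cut at the preimage of `tl a`, the right part gets the label `a`, and
there the map becomes the second iterate. -/
def botWins (S : GapMap ι) (a b : ι) : GapMap ι where
  letters := S.letters
  tl := Function.update S.tl a (S.g b (S.tl a))
  tr := Function.update (Function.update S.tr a (S.tr b)) b (S.g b (S.tl a))
  bl := S.bl
  br := Function.update S.br b (S.tl a)
  f := Function.update S.f a (S.f a ∘ S.f b)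
  g := Function.update S.g a (S.g b ∘ S.g a)

/-- First return map to `[0, tl a)` when `tl a = bl b` and neither interval wins: `a` disappears,
and on `b` the map becomes the second iterate. -/
def noneWins (S : GapMap ι) (a b : ι) : GapMap ι where
  letters := S.letters.erase a
  tl := S.tl
  tr := S.tr
  bl := Function.update S.bl b (S.bl a)
  br := Function.update S.br b (S.br a)
  f := Function.update S.f b (S.f a ∘ S.f b)
  g := Function.update S.g b (S.g b ∘ S.g a)

/-- The top interval `a` is cut at `c`. -/
def cutTop (S : GapMap ι) (a : ι) (c : ℝ) : GapMap ι :=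
  { S with tr := Function.update S.tr a c, br := Function.update S.br a (S.f a c) }

/-- The bottom interval `b` is cut at `c`. -/
def cutBot (S : GapMap ι) (b : ι) (c : ℝ) : GapMap ι :=
  { S with br := Function.update S.br b c, tr := Function.update S.tr b (S.g b c) }

/-- `S.RVStep w l S'`: one elementary step of Rauzy–Veech induction leads from `S` to `S'`; `w` and
`l` are the labels of the winning and of the losing interval (`none` if there is no such interval,
in particular if the winner or the loser is a gap). No step is made from a cylinder whose top and
bottom right endpoints agree, since the renormalization scheme stops there. -/
inductive RVStep (S : GapMap ι) : Option ι → Option ι → GapMap ι → Prop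
  | top_wins (a b : ι) (ha : S.IsTopLast a) (hb : S.IsBotLast b) (hab : a ≠ b)
      (hr : S.tr a = S.br b) (hl : S.tl a < S.bl b) :
      RVStep S (some a) (some b) (S.topWins a b)
  | bot_wins (a b : ι) (ha : S.IsTopLast a) (hb : S.IsBotLast b) (hab : a ≠ b)
      (hr : S.tr a = S.br b) (hl : S.bl b < S.tl a) :
      RVStep S (some b) (some a) (S.botWins a b)
  | none_wins (a b : ι) (ha : S.IsTopLast a) (hb : S.IsBotLast b) (hab : a ≠ b)
      (hr : S.tr a = S.br b) (hl : S.tl a = S.bl b) :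
      RVStep S none none (S.noneWins a b)
  | top_wins_gap (a b : ι) (ha : S.IsTopLast a) (hb : S.IsBotLast b)
      (hr : S.br b < S.tr a) (hl : S.tl a < S.br b) :
      RVStep S (some a) none (S.cutTop a (S.br b))
  | bot_wins_gap (a b : ι) (ha : S.IsTopLast a) (hb : S.IsBotLast b)
      (hr : S.tr a < S.br b) (hl : S.bl b < S.tr a) :
      RVStep S (some b) none (S.cutBot b (S.tr a))
  | bot_gap_wins (a b : ι) (ha : S.IsTopLast a) (hb : S.IsBotLast b)
      (hr : S.br b < S.tr a) (hl : S.br b ≤ S.tl a) :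
      RVStep S none (some a) (S.restrict (S.letters.erase a))
  | top_gap_wins (a b : ι) (ha : S.IsTopLast a) (hb : S.IsBotLast b)
      (hr : S.tr a < S.br b) (hl : S.tr a ≤ S.bl b) :
      RVStep S none (some b) (S.restrict (S.letters.erase b))

/-- `S'` is obtained from `S` by finitely many (possibly zero) steps of the induction. -/
def RVReach : GapMap ι → GapMap ι → Prop :=
  Relation.ReflTransGen fun S S' => ∃ w l, S.RVStep w l S'

/-- The rightmost top and the rightmost bottom interval have the same label and the same right
endpoint. -/
def IsCylinder (S : GapMap ι) (a : ι) : Prop :=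
  S.IsTopLast a ∧ S.IsBotLast a ∧ S.tr a = S.br a

/-- The infinite sequence of iterates of `s 0` under the induction, with winners `w n` and losers
`l n` of the step from `s n` to `s (n + 1)`. -/
def IsRVOrbit (s : ℕ → GapMap ι) (w l : ℕ → Option ι) : Prop :=
  ∀ n, (s n).RVStep (w n) (l n) (s (n + 1))

/-- `s N` is RV-stable: from `N` on no interval is lost, and each letter wins never or infinitely
often, and loses never or infinitely often. -/
def IsRVStable (s : ℕ → GapMap ι) (w l : ℕ → Option ι) (N : ℕ) : Prop :=
  (∀ n ≥ N, (s n).letters = (s N).letters) ∧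
    ∀ α ∈ (s N).letters,
      ((∀ n ≥ N, w n ≠ some α) ∨ ∃ᶠ n in atTop, w n = some α) ∧
      ((∀ n ≥ N, l n ≠ some α) ∨ ∃ᶠ n in atTop, l n = some α)

/-- The right endpoint of the rightmost top interval. -/
noncomputable def topEnd (S : GapMap ι) : ℝ := sSup (S.tr '' S.letters)

/-! ### The renormalization scheme and the decomposition -/

/-- `Scheme S L`: starting from `S`, the renormalization scheme can output the list `L` of base maps
`T_i : E_i^t → E_i^b`.
* If the induction removes all intervals, there is no output.
* If it reaches a cylinder with equal right endpoints, the cylinder is the output, and the scheme is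
  restarted with the remaining intervals.
* If it goes on forever, one takes an RV-stable iterate; the output is its restriction to the letters
  that win infinitely often, and the scheme is restarted with the remaining letters, unless the
  right endpoints tend to `0`, in which case it stops. -/
inductive Scheme : GapMap ι → List (GapMap ι) → Prop
  | trivial (S S' : GapMap ι) (h : RVReach S S') (h0 : S'.letters = ∅) : Scheme S []
  | cylinder (S S' : GapMap ι) (a : ι) (L : List (GapMap ι)) (h : RVReach S S')
      (ha : S'.IsCylinder a) (hL : Scheme (S'.restrict (S'.letters.erase a)) L) :
      Scheme S (S'.restrict {a} :: L)
  | finish (s : ℕ → GapMap ι) (w l : ℕ → Option ι) (N : ℕ) (E : Finset ι)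
      (hs : IsRVOrbit s w l) (hN : IsRVStable s w l N)
      (hE : ∀ α, α ∈ E ↔ α ∈ (s N).letters ∧ ∃ᶠ n in atTop, w n = some α)
      (hlim : Tendsto (fun n => (s n).topEnd) atTop (𝓝 0)) :
      Scheme (s 0) [(s N).restrict E]
  | restart (s : ℕ → GapMap ι) (w l : ℕ → Option ι) (N : ℕ) (E : Finset ι) (L : List (GapMap ι))
      (hs : IsRVOrbit s w l) (hN : IsRVStable s w l N)
      (hE : ∀ α, α ∈ E ↔ α ∈ (s N).letters ∧ ∃ᶠ n in atTop, w n = some α)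
      (hlim : ¬ Tendsto (fun n => (s n).topEnd) atTop (𝓝 0))
      (hL : Scheme ((s N).restrict ((s N).letters \ E)) L) :
      Scheme (s 0) ((s N).restrict E :: L)

/-- `T` has a tower representation over `B` with heights `n`: over each top interval of `B` the
floors are pairwise disjoint and contained in the domain of `T`, and `B` is the iterate `T^(n α)`
there. -/
def IsTowerRep (T B : GapMap ι) (n : ι → ℕ) : Prop :=
  ∀ α ∈ B.letters, 0 < n α ∧
    (∀ j < n α, T.toFun^[j] '' Ico (B.tl α) (B.tr α) ⊆ T.topSet) ∧
    (∀ i < n α, ∀ j < n α, i ≠ j →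
      Disjoint (T.toFun^[i] '' Ico (B.tl α) (B.tr α)) (T.toFun^[j] '' Ico (B.tl α) (B.tr α))) ∧
    ∀ x ∈ Ico (B.tl α) (B.tr α), B.f α x = T.toFun^[n α] x

/-- The union of the towers over the top intervals of `B`. -/
def rep (T B : GapMap ι) (n : ι → ℕ) : Set ℝ :=
  ⋃ α ∈ B.letters, ⋃ j ∈ Finset.range (n α), T.toFun^[j] '' Ico (B.tl α) (B.tr α)

/-- The sets in the list `L` are the domains `R_1, …, R_k` of a decomposition of `T` produced by the
renormalization scheme: `R_i` is the tower representation of `T` over the `i`-th output. -/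
def IsDecomposition (T : GapMap ι) (L : List (Set ℝ)) : Prop :=
  ∃ B : List (GapMap ι), Scheme T B ∧
    List.Forall₂ (fun B R => ∃ n, IsTowerRep T B n ∧ R = rep T B n) B L

/-- Number of periodic domains among the sets in `L`. -/
noncomputable def numPeriodic (T : GapMap ι) (L : List (Set ℝ)) : ℕ :=
  Nat.card {i : Fin L.length // T.IsPeriodicDomain (L.get i)}

/-- Number of quasiminimal domains among the sets in `L`. -/
noncomputable def numQuasiminimal (T : GapMap ι) (L : List (Set ℝ)) : ℕ :=
  Nat.card {i : Fin L.length // T.IsQuasiminimalDomain (L.get i)}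

end GapMap

/-!
Cutting an interval shrinks a tower, and composing two branches stacks a tower on a part of another
one, so every map met by the induction is carried by pairwise disjoint towers of `T`. The outputs of
the scheme use disjoint sets of letters, hence it suffices to charge every domain to the letters of
its own base map. A periodic domain needs one letter. A quasiminimal domain needs two: on a tower
over a single interval the first return map to the base is increasing, its orbits are monotone
sequences, and the starting point of a monotone sequence is not one of its accumulation points.
-/

/-! ### Towers over an interval with increasing return map -/

section MonotoneIterates

variable {X : Type*} [LinearOrder X] {G : X → X} {s : Set X} {y : X}

theorem le_iterate_of_le_map_of_monotoneOn (hG : MonotoneOn G s) (hy : ∀ m, G^[m] y ∈ s)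
    (h : y ≤ G y) (m : ℕ) : y ≤ G^[m] y := by
  induction m with
  | zero => exact le_rfl
  | succ m ih =>
    rw [Function.iterate_succ_apply']
    exact h.trans (hG (hy 0) (hy m) ih)

variable [TopologicalSpace X] [OrderClosedTopology X]

theorem not_accPt_range_iterate_of_lt_map (hG : MonotoneOn G s) (hy : ∀ m, G^[m] y ∈ s)
    (h : y < G y) : ¬ AccPt y (𝓟 (range fun m => G^[m] y)) := by
  intro hacc
  obtain ⟨_, ⟨hlt, m, rfl⟩, hne⟩ := accPt_iff_nhds.1 hacc (Iio (G y)) (Iio_mem_nhds h)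
  cases m with
  | zero => exact hne rfl
  | succ m =>
    have hle : G y ≤ G^[m + 1] y := by
      rw [Function.iterate_succ_apply']
      exact hG (hy 0) (hy m) (le_iterate_of_le_map_of_monotoneOn hG hy h.le m)
    exact hle.not_gt hlt

theorem not_accPt_range_iterate (hG : MonotoneOn G s) (hy : ∀ m, G^[m] y ∈ s) :
    ¬ AccPt y (𝓟 (range fun m => G^[m] y)) := by
  rcases lt_trichotomy y (G y) with hlt | heq | hgt
  · exact not_accPt_range_iterate_of_lt_map hG hy hlt
  · intro hacc
    obtain ⟨_, ⟨-, m, rfl⟩, hne⟩ := accPt_iff_nhds.1 hacc univ univ_mem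
    exact hne (Function.iterate_fixed heq.symm m)
  · exact not_accPt_range_iterate_of_lt_map (X := Xᵒᵈ) hG.dual hy hgt

end MonotoneIterates

namespace PartialDyn

variable {F : ℝ → ℝ} {J I : Set ℝ} {x y : ℝ} {k : ℕ}

theorem self_mem_fwdOrbit : x ∈ fwdOrbit F J x :=
  ⟨0, fun _ hi => (Nat.not_lt_zero _ hi).elim, rfl⟩

theorem injOn_iterate_iterDom (h : InjOn F J) (n : ℕ) : InjOn F^[n] (iterDom F J n) := by
  induction n with
  | zero => exact injOn_id _
  | succ n ih =>
    intro x hx y hy hxy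
    rw [Function.iterate_succ_apply', Function.iterate_succ_apply'] at hxy
    exact ih (fun i hi => hx i (by omega)) (fun i hi => hy i (by omega))
      (h (hx n n.lt_succ_self) (hy n n.lt_succ_self) hxy)

theorem finite_fwdOrbit_of_isPeriodicPt (hk : 0 < k) (h : Function.IsPeriodicPt F k x) :
    (fwdOrbit F J x).Finite := by
  refine ((finite_Iio k).image fun i => F^[i] x).subset ?_
  rintro _ ⟨m, -, rfl⟩
  exact ⟨m % k, Nat.mod_lt _ hk, h.iterate_mod_apply m⟩

theorem IsRegular.iterate_mem (h : IsRegular F J x) (m : ℕ) : F^[m] x ∈ J := by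
  induction m using Nat.strong_induction_on with
  | _ m ih => exact (h (.inl ⟨m, ih, rfl⟩)).1

theorem IsRegular.iterate_mem_orbit (h : IsRegular F J x) (m : ℕ) : F^[m] x ∈ orbit F J x :=
  .inl ⟨m, fun i _ => h.iterate_mem i, rfl⟩

theorem IsNontriviallyRecurrent.infinite_fwdOrbit (h : IsNontriviallyRecurrent F J x)
    (hy : y ∈ orbit F J x) : (fwdOrbit F J y).Infinite :=
  .of_accPt (h.2 y hy).1

/-- The union of the tower of height `k` over the base `I`; its floors are the sets `F^[i] '' I`. -/
def tower (F : ℝ → ℝ) (I : Set ℝ) (k : ℕ) : Set ℝ := ⋃ i ∈ Finset.range k, F^[i] '' I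

theorem mem_tower : x ∈ tower F I k ↔ ∃ i < k, ∃ u ∈ I, F^[i] u = x := by
  simp only [tower, mem_iUnion, Finset.mem_range, mem_image, exists_prop]

/-- A Rokhlin tower of positive height `k` over the base `I`: the floors are pairwise disjoint and
`F` is injective on their union. Nothing is assumed on the image of the top floor. -/
structure IsTower (F : ℝ → ℝ) (I : Set ℝ) (k : ℕ) : Prop where
  pos : 0 < k
  disjoint : (Iio k).PairwiseDisjoint fun i => F^[i] '' I
  injOn : InjOn F (tower F I k)

namespace IsTower

theorem eq_zero_of_iterate_mem (h : IsTower F I k) {i : ℕ} (hi : i < k) (hx : x ∈ I)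
    (hxi : F^[i] x ∈ I) : i = 0 := by
  by_contra h0
  exact disjoint_left.1 (h.disjoint hi h.pos h0) ⟨x, hx, rfl⟩ ⟨_, hxi, rfl⟩

theorem iterate_height_mem (h : IsTower F I k) (hx : x ∈ I) (hxk : F^[k] x ∈ tower F I k) :
    F^[k] x ∈ I := by
  obtain ⟨i, hi, u, hu, hux⟩ := mem_tower.1 hxk
  have hxu : F^[k - i] x = u := by
    refine injOn_iterate_iterDom h.injOn i (fun j hj => ?_) (fun j hj => ?_) ?_
    · rw [← Function.iterate_add_apply]
      exact mem_tower.2 ⟨_, by omega, x, hx, rfl⟩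
    · exact mem_tower.2 ⟨j, hj.trans hi, u, hu, rfl⟩
    · rw [hux, ← Function.iterate_add_apply, Nat.add_sub_cancel' hi.le]
  rcases i.eq_zero_or_pos with rfl | h0
  · exact hux ▸ hu
  · have := h.eq_zero_of_iterate_mem (i := k - i) (by omega) hx (hxu ▸ hu)
    omega

theorem iterate_iterate_height_mem (h : IsTower F I k) (hx : x ∈ I)
    (hxt : ∀ m, F^[m] x ∈ tower F I k) (m : ℕ) : (F^[k])^[m] x ∈ I := by
  induction m with
  | zero => exact hx
  | succ m ih =>
    rw [Function.iterate_succ_apply']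
    refine h.iterate_height_mem ih ?_
    rw [← Function.iterate_mul, ← Function.iterate_add_apply]
    exact hxt _

theorem inter_fwdOrbit_subset (h : IsTower F I k) (hx : ∀ m, (F^[k])^[m] x ∈ I) :
    I ∩ fwdOrbit F J x ⊆ range fun m => (F^[k])^[m] x := by
  rintro _ ⟨hm, m, -, rfl⟩
  have hdiv : F^[m] x = F^[m % k] ((F^[k])^[m / k] x) := by
    rw [← Function.iterate_mul, ← Function.iterate_add_apply, Nat.mod_add_div]
  rw [hdiv] at hm ⊢
  rw [h.eq_zero_of_iterate_mem (Nat.mod_lt _ h.pos) (hx _) hm]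
  exact ⟨m / k, rfl⟩

theorem exists_iterate_forall_return_mem (h : IsTower F I k) (hx : x ∈ tower F I k)
    (hreg : IsRegular F (tower F I k) x) :
    ∃ m, ∀ j, (F^[k])^[j] (F^[m] x) ∈ I := by
  obtain ⟨i, hi, u, hu, rfl⟩ := mem_tower.1 hx
  have hret : F^[k - i] (F^[i] u) = F^[k] u := by
    rw [← Function.iterate_add_apply, Nat.sub_add_cancel hi.le]
  have hmem : F^[k - i] (F^[i] u) ∈ I := by
    rw [hret]
    exact h.iterate_height_mem hu (hret ▸ hreg.iterate_mem _)
  refine ⟨k - i, h.iterate_iterate_height_mem hmem fun m => ?_⟩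
  rw [← Function.iterate_add_apply]
  exact hreg.iterate_mem _

theorem not_isNontriviallyRecurrent {l r : ℝ} (h : IsTower F (Ico l r) k)
    (hmono : MonotoneOn F^[k] (Ico l r)) (hx : x ∈ tower F (Ico l r) k) :
    ¬ IsNontriviallyRecurrent F (tower F (Ico l r) k) x := by
  intro hrec
  have not_interior : ∀ m, (∀ j, (F^[k])^[j] (F^[m] x) ∈ Ico l r) → ¬ l < F^[m] x := by
    intro m hm hl
    have hacc := (hrec.2 _ (hrec.1.iterate_mem_orbit m)).1.nhds_inter
      (Ico_mem_nhds hl (hm 0).2)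
    exact not_accPt_range_iterate hmono hm
      (hacc.mono (principal_mono.2 (h.inter_fwdOrbit_subset hm)))
  obtain ⟨m, hm⟩ := h.exists_iterate_forall_return_mem hx hrec.1
  -- The base is no neighbourhood of its endpoint `l`, so an orbit through `l` is followed to its
  -- first return, which is interior unless `l` is periodic.
  have hleft : F^[m] x = l := ((hm 0).1.eq_of_not_lt (not_interior m hm)).symm
  have hret : F^[k + m] x = F^[k] (F^[m] x) := Function.iterate_add_apply F k m x
  have hleft' : F^[k + m] x = l := by
    refine le_antisymm ?_ ?_
    · refine not_lt.1 (not_interior _ fun j => ?_)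
      rw [hret, ← Function.iterate_succ_apply]
      exact hm (j + 1)
    · exact hret ▸ (hm 1).1
  refine hrec.infinite_fwdOrbit (hrec.1.iterate_mem_orbit m)
    (finite_fwdOrbit_of_isPeriodicPt h.pos ?_)
  exact (hret.symm.trans hleft').trans hleft.symm

end IsTower

end PartialDyn

/-! ### Branches of the maps met by the induction -/

/-- `f` is an increasing bijection from `[a, b]` onto `[c, d]` with inverse `g`. -/
structure IsBranch {X Y : Type*} [LinearOrder X] [LinearOrder Y] (a b : X) (c d : Y)
    (f : X → Y) (g : Y → X) : Prop where
  le : a ≤ b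
  strictMonoOn : StrictMonoOn f (Icc a b)
  map_left : f a = c
  map_right : f b = d
  mapsTo_inv : MapsTo g (Icc c d) (Icc a b)
  rightInv : RightInvOn g f (Icc c d)

namespace IsBranch

variable {X Y Z : Type*} [LinearOrder X] [LinearOrder Y] [LinearOrder Z] {a b x : X} {c d y : Y}
  {p q : Z} {f : X → Y} {g : Y → X} {f' : Y → Z} {g' : Z → Y}

theorem mapsTo (h : IsBranch a b c d f g) : MapsTo f (Icc a b) (Icc c d) :=
  h.map_left ▸ h.map_right ▸ h.strictMonoOn.monotoneOn.mapsTo_Icc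

theorem mapsTo_Ico (h : IsBranch a b c d f g) : MapsTo f (Ico a b) (Ico c d) :=
  h.map_left ▸ h.map_right ▸ h.strictMonoOn.mapsTo_Ico

theorem injOn_Ico (h : IsBranch a b c d f g) : InjOn f (Ico a b) :=
  h.strictMonoOn.injOn.mono Ico_subset_Icc_self

theorem image_le (h : IsBranch a b c d f g) : c ≤ d :=
  (h.mapsTo (left_mem_Icc.2 h.le)).1.trans (h.mapsTo (left_mem_Icc.2 h.le)).2

theorem cutRight (h : IsBranch a b c d f g) (hx : x ∈ Icc a b) : IsBranch a x c (f x) f g where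
  le := hx.1
  strictMonoOn := h.strictMonoOn.mono (Icc_subset_Icc_right hx.2)
  map_left := h.map_left
  map_right := rfl
  mapsTo_inv y hy := by
    have hy' : y ∈ Icc c d := ⟨hy.1, hy.2.trans (h.mapsTo hx).2⟩
    refine ⟨(h.mapsTo_inv hy').1, (h.strictMonoOn.le_iff_le (h.mapsTo_inv hy') hx).1 ?_⟩
    exact (h.rightInv hy').trans_le hy.2
  rightInv _ hy := h.rightInv ⟨hy.1, hy.2.trans (h.mapsTo hx).2⟩

theorem cutLeft (h : IsBranch a b c d f g) (hx : x ∈ Icc a b) : IsBranch x b (f x) d f g where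
  le := hx.2
  strictMonoOn := h.strictMonoOn.mono (Icc_subset_Icc_left hx.1)
  map_left := rfl
  map_right := h.map_right
  mapsTo_inv y hy := by
    have hy' : y ∈ Icc c d := ⟨(h.mapsTo hx).1.trans hy.1, hy.2⟩
    refine ⟨(h.strictMonoOn.le_iff_le hx (h.mapsTo_inv hy')).1 ?_, (h.mapsTo_inv hy').2⟩
    exact hy.1.trans_eq (h.rightInv hy').symm
  rightInv _ hy := h.rightInv ⟨(h.mapsTo hx).1.trans hy.1, hy.2⟩

theorem cutRight_inv (h : IsBranch a b c d f g) (hy : y ∈ Icc c d) :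
    IsBranch a (g y) c y f g := by
  simpa only [h.rightInv hy] using h.cutRight (h.mapsTo_inv hy)

theorem cutLeft_inv (h : IsBranch a b c d f g) (hy : y ∈ Icc c d) :
    IsBranch (g y) b y d f g := by
  simpa only [h.rightInv hy] using h.cutLeft (h.mapsTo_inv hy)

theorem comp (h : IsBranch a b c d f g) (h' : IsBranch c d p q f' g') :
    IsBranch a b p q (f' ∘ f) (g ∘ g') where
  le := h.le
  strictMonoOn := h'.strictMonoOn.comp h.strictMonoOn h.mapsTo
  map_left := (congrArg f' h.map_left).trans h'.map_left
  map_right := (congrArg f' h.map_right).trans h'.map_right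
  mapsTo_inv := h.mapsTo_inv.comp h'.mapsTo_inv
  rightInv _ hy := (congrArg f' (h.rightInv (h'.mapsTo_inv hy))).trans (h'.rightInv hy)

end IsBranch

namespace GapMap

section Branches

variable {ι : Type*} {r : ℕ∞} {S S' : GapMap ι} {α : ι} {x : ℝ}

/-- The top interval labelled `α`. -/
abbrev topInterval (S : GapMap ι) (α : ι) : Set ℝ := Ico (S.tl α) (S.tr α)

/-- Every `f α` maps its closed top interval increasingly onto its closed bottom interval, with
inverse `g α`: the part of `IsGGIET` that the induction transports from one map to the next. -/
def HasBranches (S : GapMap ι) : Prop :=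
  ∀ α ∈ S.letters, IsBranch (S.tl α) (S.tr α) (S.bl α) (S.br α) (S.f α) (S.g α)

theorem mem_topSet : x ∈ S.topSet ↔ ∃ α ∈ S.letters, x ∈ S.topInterval α := by
  simp only [topSet, mem_iUnion, exists_prop]

theorem IsGGIET.hasBranches (h : S.IsGGIET r) : S.HasBranches := by
  intro α hα
  have hle := (h.top_lt α hα).le
  have hble := (h.bot_lt α hα).le
  have hmono := (h.strictMonoOn α hα).monotoneOn
  have himage : S.f α '' Icc (S.tl α) (S.tr α) = Icc (S.bl α) (S.br α) :=
    ((h.invOn α hα).bijOn (h.mapsTo α hα) (h.mapsTo_inv α hα)).image_eq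
  exact
    { le := hle
      strictMonoOn := h.strictMonoOn α hα
      map_left := (himage ▸ hmono.map_isLeast (isLeast_Icc hle)).unique (isLeast_Icc hble)
      map_right :=
        (himage ▸ hmono.map_isGreatest (isGreatest_Icc hle)).unique (isGreatest_Icc hble)
      mapsTo_inv := h.mapsTo_inv α hα
      rightInv := (h.invOn α hα).2 }

theorem IsGGIET.eqOn_toFun (h : S.IsGGIET r) (hα : α ∈ S.letters) :
    EqOn S.toFun (S.f α) (S.topInterval α) := by
  intro x hx
  have hex : ∃ α ∈ S.letters, x ∈ S.topInterval α := ⟨α, hα, hx⟩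
  obtain ⟨hmem, hxc⟩ := hex.choose_spec
  have hchoose : hex.choose = α := by
    by_contra hne
    exact disjoint_left.1 (h.top_disjoint _ hmem _ hα hne) hxc hx
  rw [toFun, dif_pos hex, hchoose]

theorem IsGGIET.injOn_toFun (h : S.IsGGIET r) : InjOn S.toFun S.topSet := by
  intro x hx y hy hxy
  obtain ⟨α, hα, hx⟩ := mem_topSet.1 hx
  obtain ⟨β, hβ, hy⟩ := mem_topSet.1 hy
  rw [h.eqOn_toFun hα hx, h.eqOn_toFun hβ hy] at hxy
  obtain rfl : α = β := by
    by_contra hne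
    exact disjoint_left.1 (h.bot_disjoint α hα β hβ hne) ((h.hasBranches α hα).mapsTo_Ico hx)
      (hxy ▸ (h.hasBranches β hβ).mapsTo_Ico hy)
  exact (h.hasBranches α hα).injOn_Ico hx hy hxy

theorem HasBranches.restrict (h : S.HasBranches) {E : Finset ι} (hE : E ⊆ S.letters) :
    (S.restrict E).HasBranches := fun α hα => h α (hE hα)

variable [DecidableEq ι] {a b : ι} {c : ℝ} {w l : Option ι}

theorem HasBranches.cutTop (h : S.HasBranches) (hc : c ∈ Icc (S.tl a) (S.tr a)) :
    (S.cutTop a c).HasBranches := by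
  intro α hα
  rcases eq_or_ne α a with rfl | hαa
  · simpa [GapMap.cutTop] using (h α hα).cutRight hc
  · simpa [GapMap.cutTop, hαa] using h α hα

theorem HasBranches.cutBot (h : S.HasBranches) (hc : c ∈ Icc (S.bl b) (S.br b)) :
    (S.cutBot b c).HasBranches := by
  intro α hα
  rcases eq_or_ne α b with rfl | hαb
  · simpa [GapMap.cutBot] using (h α hα).cutRight_inv hc
  · simpa [GapMap.cutBot, hαb] using h α hα

theorem HasBranches.topWins (h : S.HasBranches) (ha : a ∈ S.letters) (hb : b ∈ S.letters)
    (hab : a ≠ b) (hr : S.tr a = S.br b) (hl : S.tl a ≤ S.bl b) :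
    (S.topWins a b).HasBranches := by
  have hc : S.bl b ∈ Icc (S.tl a) (S.tr a) := ⟨hl, hr ▸ (h b hb).image_le⟩
  intro α hα
  rcases eq_or_ne α a with rfl | hαa
  · simpa [GapMap.topWins, hab] using (h α ha).cutRight hc
  rcases eq_or_ne α b with rfl | hαb
  · simpa [GapMap.topWins, hαa] using (hr ▸ h α hb).comp ((h a ha).cutLeft hc)
  · simpa [GapMap.topWins, hαa, hαb] using h α hα

theorem HasBranches.botWins (h : S.HasBranches) (ha : a ∈ S.letters) (hb : b ∈ S.letters)
    (hab : a ≠ b) (hr : S.tr a = S.br b) (hl : S.bl b ≤ S.tl a) :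
    (S.botWins a b).HasBranches := by
  have hc : S.tl a ∈ Icc (S.bl b) (S.br b) := ⟨hl, hr ▸ (h a ha).le⟩
  intro α hα
  rcases eq_or_ne α a with rfl | hαa
  · simpa [GapMap.botWins, hab] using ((h b hb).cutLeft_inv hc).comp (hr ▸ h α ha)
  rcases eq_or_ne α b with rfl | hαb
  · simpa [GapMap.botWins, hαa] using (h α hb).cutRight_inv hc
  · simpa [GapMap.botWins, hαa, hαb] using h α hα

theorem HasBranches.noneWins (h : S.HasBranches) (ha : a ∈ S.letters) (hb : b ∈ S.letters)
    (hr : S.tr a = S.br b) (hl : S.tl a = S.bl b) : (S.noneWins a b).HasBranches := by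
  intro α hα
  rcases eq_or_ne α b with rfl | hαb
  · simpa [GapMap.noneWins] using (h α hb).comp (hr ▸ hl ▸ h a ha)
  · simpa [GapMap.noneWins, hαb] using h α (Finset.mem_of_mem_erase hα)

theorem RVStep.hasBranches (hs : S.RVStep w l S') (h : S.HasBranches) : S'.HasBranches := by
  cases hs with
  | top_wins _ _ ha hb hab hr hl => exact h.topWins ha.1 hb.1 hab hr hl.le
  | bot_wins _ _ ha hb hab hr hl => exact h.botWins ha.1 hb.1 hab hr hl.le
  | none_wins _ _ ha hb _ hr hl => exact h.noneWins ha.1 hb.1 hr hl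
  | top_wins_gap _ _ _ _ hr hl => exact h.cutTop ⟨hl.le, hr.le⟩
  | bot_wins_gap _ _ _ _ hr hl => exact h.cutBot ⟨hl.le, hr.le⟩
  | bot_gap_wins => exact h.restrict (Finset.erase_subset _ _)
  | top_gap_wins => exact h.restrict (Finset.erase_subset _ _)

end Branches

/-! ### Towers along the induction -/

section Towers

variable {ι : Type*} {r : ℕ∞} {F : ℝ → ℝ} {X : Set ℝ} {S S' : GapMap ι} {n : ι → ℕ} {α : ι}
  {i : ℕ} {x : ℝ}

/-- The points of the abstract towers of heights `n` over the top intervals of `S`: `(α, i, x)` is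
the point of the `i`-th floor above the point `x` of the base `α`. -/
def towerPoints (S : GapMap ι) (n : ι → ℕ) : Set (ι × ℕ × ℝ) :=
  {p | p.1 ∈ S.letters ∧ p.2.1 < n p.1 ∧ p.2.2 ∈ S.topInterval p.1}

/-- The realization `(α, i, x) ↦ F^[i] x` of the abstract towers. -/
def towerProj (F : ℝ → ℝ) (p : ι × ℕ × ℝ) : ℝ := F^[p.2.1] p.2.2

/-- `S` is carried by towers of `F`: on the top interval `α` it is the iterate `F^[n α]`, and the
floors of the towers of heights `n` lie in `X` and are pairwise disjoint. Injectivity of `towerProj`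
expresses disjointness, across the towers as well as within each of them, together with the
injectivity of `F` along the towers. -/
structure HasTowers (F : ℝ → ℝ) (X : Set ℝ) (S : GapMap ι) (n : ι → ℕ) : Prop where
  pos : ∀ α ∈ S.letters, 0 < n α
  eqOn_iterate : ∀ α ∈ S.letters, EqOn (S.f α) F^[n α] (S.topInterval α)
  mapsTo : MapsTo (towerProj F) (S.towerPoints n) X
  injOn : InjOn (towerProj F) (S.towerPoints n)

theorem IsGGIET.hasTowers {T : GapMap ι} (h : T.IsGGIET r) :
    T.HasTowers T.toFun T.topSet fun _ => 1 where
  pos _ _ := one_pos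
  eqOn_iterate _ hα := (h.eqOn_toFun hα).symm
  mapsTo := by
    rintro ⟨α, i, x⟩ ⟨hα, hi, hx⟩
    obtain rfl : i = 0 := Nat.lt_one_iff.1 hi
    exact mem_topSet.2 ⟨α, hα, hx⟩
  injOn := by
    rintro ⟨α, i, x⟩ ⟨hα, hi, hx⟩ ⟨β, j, y⟩ ⟨hβ, hj, hy⟩ hxy
    obtain rfl : i = 0 := Nat.lt_one_iff.1 hi
    obtain rfl : j = 0 := Nat.lt_one_iff.1 hj
    obtain rfl : x = y := hxy
    obtain rfl : α = β := by
      by_contra hne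
      exact disjoint_left.1 (h.top_disjoint α hα β hβ hne) hx hy
    rfl

namespace HasTowers

theorem isTowerRep {T B : GapMap ι} (h : B.HasTowers T.toFun T.topSet n) : IsTowerRep T B n := by
  refine fun α hα => ⟨h.pos α hα, fun j hj => ?_, fun i hi j hj hij => ?_, h.eqOn_iterate α hα⟩
  · rintro _ ⟨x, hx, rfl⟩
    exact h.mapsTo (x := (α, j, x)) ⟨hα, hj, hx⟩
  · rw [disjoint_left]
    rintro _ ⟨x, hx, rfl⟩ ⟨y, hy, hyx⟩
    have heq := h.injOn (x₁ := (α, j, y)) (x₂ := (α, i, x)) ⟨hα, hj, hy⟩ ⟨hα, hi, hx⟩ hyx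
    exact hij (congrArg (fun p : ι × ℕ × ℝ => p.2.1) heq).symm

theorem shrink (h : S.HasTowers F X n) (hL : S'.letters ⊆ S.letters)
    (hI : ∀ α ∈ S'.letters, S'.topInterval α ⊆ S.topInterval α)
    (hf : ∀ α ∈ S'.letters, S'.f α = S.f α) : S'.HasTowers F X n := by
  have hsub : S'.towerPoints n ⊆ S.towerPoints n := fun p hp =>
    ⟨hL hp.1, hp.2.1, hI _ hp.1 hp.2.2⟩
  exact
    { pos := fun α hα => h.pos α (hL hα)
      eqOn_iterate := fun α hα => hf α hα ▸ (h.eqOn_iterate α (hL hα)).mono (hI α hα)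
      mapsTo := h.mapsTo.mono_left hsub
      injOn := h.injOn.mono hsub }

theorem restrict (h : S.HasTowers F X n) {E : Finset ι} (hE : E ⊆ S.letters) :
    (S.restrict E).HasTowers F X n :=
  h.shrink hE (fun _ _ => Subset.rfl) fun _ _ => rfl

variable [DecidableEq ι] {a b : ι} {t : ℝ}

theorem cutTop (h : S.HasTowers F X n) (ht : t ≤ S.tr a) : (S.cutTop a t).HasTowers F X n := by
  refine h.shrink Subset.rfl (fun α _ => Ico_subset_Ico_right ?_) fun _ _ => rfl
  exact update_le_self_iff.2 ht α

theorem cutBot (h : S.HasTowers F X n) (ht : S.g b t ≤ S.tr b) :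
    (S.cutBot b t).HasTowers F X n := by
  refine h.shrink Subset.rfl (fun α _ => Ico_subset_Ico_right ?_) fun _ _ => rfl
  exact update_le_self_iff.2 ht α

end HasTowers

section Stacking

variable [DecidableEq ι] {a b c : ι} {φ : ℝ → ℝ} {m : ℕ}

/-- `S'` arises from `S` by stacking the tower of `a` on a part of the tower of `b`: the interval
labelled `c` of `S'` is that part of the base `b`, and on it `S'` is the composition of the two
branches. The remaining parts of the bases `a` and `b` may keep their labels. -/
structure IsStacking (S S' : GapMap ι) (a b c : ι) : Prop where
  letters_subset : S'.letters ⊆ S.letters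
  top_mem : a ∈ S.letters
  bot_mem : b ∈ S.letters
  ne : a ≠ b
  topInterval_subset : ∀ α ∈ S'.letters, α ≠ c → S'.topInterval α ⊆ S.topInterval α
  f_eq : ∀ α ∈ S'.letters, α ≠ c → S'.f α = S.f α
  stacked_subset : S'.topInterval c ⊆ S.topInterval b
  stacked_f_eq : S'.f c = S.f a ∘ S.f b
  mapsTo : MapsTo (S.f b) (S'.topInterval c) (S.topInterval a)
  injOn : InjOn (S.f b) (S'.topInterval c)
  disjoint_bot : b ∈ S'.letters → b ≠ c → Disjoint (S'.topInterval b) (S'.topInterval c)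
  disjoint_top :
    a ∈ S'.letters → a ≠ c → Disjoint (S'.topInterval a) (S.f b '' S'.topInterval c)

/-- The point of the towers of `S` under a point of the towers of a stacking `S'`: the `i`-th floor
of the stacked tower `c` is the `i`-th floor of `b` for `i` below the height `m` of `b`, and the
`(i - m)`-th floor of `a` over the image of the base point under `φ`, the branch `b`, otherwise. -/
def stackMap (φ : ℝ → ℝ) (a b c : ι) (m : ℕ) (p : ι × ℕ × ℝ) : ι × ℕ × ℝ :=
  if p.1 = c then if p.2.1 < m then (b, p.2) else (a, p.2.1 - m, φ p.2.2) else p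

theorem stackMap_of_ne (hα : α ≠ c) : stackMap φ a b c m (α, i, x) = (α, i, x) :=
  if_neg hα

theorem stackMap_of_lt (hi : i < m) : stackMap φ a b c m (c, i, x) = (b, i, x) :=
  (if_pos rfl).trans (if_pos hi)

theorem stackMap_of_le (hi : m ≤ i) : stackMap φ a b c m (c, i, x) = (a, i - m, φ x) :=
  (if_pos rfl).trans (if_neg hi.not_gt)

namespace IsStacking

theorem mapsTo_stackMap (h : IsStacking S S' a b c) :
    MapsTo (stackMap (S.f b) a b c (n b)) (S'.towerPoints (Function.update n c (n b + n a)))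
      (S.towerPoints n) := by
  rintro ⟨α, i, x⟩ ⟨hα, hi, hx⟩
  dsimp only at hα hi hx
  rcases eq_or_ne α c with rfl | hαc
  · rw [Function.update_self] at hi
    rcases lt_or_ge i (n b) with hib | hib
    · rw [stackMap_of_lt hib]
      exact ⟨h.bot_mem, hib, h.stacked_subset hx⟩
    · rw [stackMap_of_le hib]
      exact ⟨h.top_mem, by dsimp only; omega, h.mapsTo hx⟩
  · rw [Function.update_of_ne hαc] at hi
    rw [stackMap_of_ne hαc]
    exact ⟨h.letters_subset hα, hi, h.topInterval_subset α hα hαc hx⟩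

theorem stackMap_ne (h : IsStacking S S' a b c) {β : ι} {j : ℕ} {y : ℝ} (hβ : β ∈ S'.letters)
    (hβc : β ≠ c) (hy : y ∈ S'.topInterval β) (hx : x ∈ S'.topInterval c) :
    stackMap (S.f b) a b c m (c, i, x) ≠ (β, j, y) := by
  rcases lt_or_ge i m with him | him
  · rw [stackMap_of_lt him]
    rintro ⟨⟩
    exact disjoint_left.1 (h.disjoint_bot hβ hβc) hy hx
  · rw [stackMap_of_le him]
    rintro ⟨⟩
    exact disjoint_left.1 (h.disjoint_top hβ hβc) hy (mem_image_of_mem _ hx)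

theorem injOn_stackMap (h : IsStacking S S' a b c) :
    InjOn (stackMap (S.f b) a b c m) (S'.towerPoints n) := by
  rintro ⟨α, i, x⟩ ⟨hα, -, hx⟩ ⟨β, j, y⟩ ⟨hβ, -, hy⟩ hxy
  rcases eq_or_ne α c with hαc | hαc <;> rcases eq_or_ne β c with hβc | hβc
  · subst hαc hβc
    rcases lt_or_ge i m with him | him <;> rcases lt_or_ge j m with hjm | hjm
    · rw [stackMap_of_lt him, stackMap_of_lt hjm] at hxy
      exact congrArg (Prod.mk _) (congrArg Prod.snd hxy)
    · rw [stackMap_of_lt him, stackMap_of_le hjm] at hxy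
      exact (h.ne (congrArg Prod.fst hxy).symm).elim
    · rw [stackMap_of_le him, stackMap_of_lt hjm] at hxy
      exact (h.ne (congrArg Prod.fst hxy)).elim
    · rw [stackMap_of_le him, stackMap_of_le hjm] at hxy
      simp only [Prod.mk.injEq, true_and] at hxy
      obtain rfl : i = j := by omega
      obtain rfl : x = y := h.injOn hx hy hxy.2
      rfl
  · subst hαc
    rw [stackMap_of_ne hβc] at hxy
    exact (h.stackMap_ne hβ hβc hy hx hxy).elim
  · subst hβc
    rw [stackMap_of_ne hαc] at hxy
    exact (h.stackMap_ne hα hαc hx hy hxy.symm).elim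
  · rwa [stackMap_of_ne hαc, stackMap_of_ne hβc] at hxy

theorem towerProj_stackMap (h : IsStacking S S' a b c)
    (hiter : EqOn (S.f b) F^[n b] (S.topInterval b)) {p : ι × ℕ × ℝ}
    (hp : p.2.2 ∈ S'.topInterval p.1) :
    towerProj F (stackMap (S.f b) a b c (n b) p) = towerProj F p := by
  obtain ⟨α, i, x⟩ := p
  rcases eq_or_ne α c with rfl | hαc
  · rcases lt_or_ge i (n b) with hib | hib
    · rw [stackMap_of_lt hib]
      rfl
    · rw [stackMap_of_le hib, hiter (h.stacked_subset hp)]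
      simp only [towerProj]
      rw [← Function.iterate_add_apply, Nat.sub_add_cancel hib]
  · rw [stackMap_of_ne hαc]

theorem hasTowers (h : IsStacking S S' a b c) (hS : S.HasTowers F X n) :
    S'.HasTowers F X (Function.update n c (n b + n a)) := by
  have hproj : EqOn (towerProj F ∘ stackMap (S.f b) a b c (n b)) (towerProj F)
      (S'.towerPoints (Function.update n c (n b + n a))) := fun p hp =>
    h.towerProj_stackMap (hS.eqOn_iterate b h.bot_mem) hp.2.2
  refine ⟨fun α hα => ?_, fun α hα x hx => ?_, ?_, ?_⟩
  · rcases eq_or_ne α c with rfl | hαc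
    · rw [Function.update_self]
      exact Nat.add_pos_left (hS.pos b h.bot_mem) _
    · rw [Function.update_of_ne hαc]
      exact hS.pos α (h.letters_subset hα)
  · rcases eq_or_ne α c with rfl | hαc
    · rw [Function.update_self, h.stacked_f_eq, Function.comp_apply,
        hS.eqOn_iterate a h.top_mem (h.mapsTo hx),
        hS.eqOn_iterate b h.bot_mem (h.stacked_subset hx), add_comm, Function.iterate_add_apply]
    · rw [Function.update_of_ne hαc, h.f_eq α hα hαc]
      exact hS.eqOn_iterate α (h.letters_subset hα) (h.topInterval_subset α hα hαc hx)
  · exact (hS.mapsTo.comp h.mapsTo_stackMap).congr hproj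
  · exact (hS.injOn.comp h.injOn_stackMap h.mapsTo_stackMap).congr hproj

end IsStacking

theorem HasBranches.isStacking_topWins (h : S.HasBranches) (ha : a ∈ S.letters)
    (hb : b ∈ S.letters) (hab : a ≠ b) (hr : S.tr a = S.br b) (hl : S.tl a ≤ S.bl b) :
    IsStacking S (S.topWins a b) a b b := by
  have hbI : (S.topWins a b).topInterval b = S.topInterval b := by
    simp [topInterval, GapMap.topWins, hab.symm]
  have haI : (S.topWins a b).topInterval a = Ico (S.tl a) (S.bl b) := by
    simp [topInterval, GapMap.topWins]
  have hmaps := (h b hb).mapsTo_Ico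
  exact
    { letters_subset := Subset.rfl
      top_mem := ha
      bot_mem := hb
      ne := hab
      topInterval_subset := fun α _ _ => Ico_subset_Ico_right <|
        update_le_self_iff.2 (hr ▸ (h b hb).image_le) α
      f_eq := fun α _ hα => Function.update_of_ne hα _ _
      stacked_subset := hbI.subset
      stacked_f_eq := Function.update_self _ _ _
      mapsTo := hbI ▸ hmaps.mono_right (hr ▸ Ico_subset_Ico_left hl)
      injOn := hbI ▸ (h b hb).injOn_Ico
      disjoint_bot := fun _ hne => (hne rfl).elim
      disjoint_top := fun _ _ => haI ▸ hbI ▸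
        (Ico_disjoint_Ico_same.mono_right hmaps.image_subset) }

theorem HasBranches.isStacking_botWins (h : S.HasBranches) (ha : a ∈ S.letters)
    (hb : b ∈ S.letters) (hab : a ≠ b) (hr : S.tr a = S.br b) (hl : S.bl b ≤ S.tl a) :
    IsStacking S (S.botWins a b) a b a := by
  have hc : S.tl a ∈ Icc (S.bl b) (S.br b) := ⟨hl, hr ▸ (h a ha).le⟩
  have hg := (h b hb).mapsTo_inv hc
  have haI : (S.botWins a b).topInterval a = Ico (S.g b (S.tl a)) (S.tr b) := by
    simp [topInterval, GapMap.botWins, hab]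
  have hbI : (S.botWins a b).topInterval b = Ico (S.tl b) (S.g b (S.tl a)) := by
    simp [topInterval, GapMap.botWins, hab.symm]
  exact
    { letters_subset := Subset.rfl
      top_mem := ha
      bot_mem := hb
      ne := hab
      topInterval_subset := fun α _ hα => by
        rcases eq_or_ne α b with rfl | hαb
        · exact hbI ▸ Ico_subset_Ico_right hg.2
        · simp [topInterval, GapMap.botWins, hα, hαb]
      f_eq := fun α _ hα => Function.update_of_ne hα _ _
      stacked_subset := haI ▸ Ico_subset_Ico_left hg.1
      stacked_f_eq := Function.update_self _ _ _
      mapsTo := by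
        rw [haI, topInterval, hr]
        exact ((h b hb).cutLeft_inv hc).mapsTo_Ico
      injOn := haI ▸ ((h b hb).cutLeft_inv hc).injOn_Ico
      disjoint_bot := fun _ _ => haI ▸ hbI ▸ Ico_disjoint_Ico_same
      disjoint_top := fun _ hne => (hne rfl).elim }

theorem HasBranches.isStacking_noneWins (h : S.HasBranches) (ha : a ∈ S.letters)
    (hb : b ∈ S.letters) (hab : a ≠ b) (hr : S.tr a = S.br b) (hl : S.tl a = S.bl b) :
    IsStacking S (S.noneWins a b) a b b where
  letters_subset := Finset.erase_subset _ _
  top_mem := ha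
  bot_mem := hb
  ne := hab
  topInterval_subset _ _ _ := Subset.rfl
  f_eq _ _ hα := Function.update_of_ne hα _ _
  stacked_subset := Subset.rfl
  stacked_f_eq := Function.update_self _ _ _
  mapsTo := by
    have := (h b hb).mapsTo_Ico
    rwa [← hl, ← hr] at this
  injOn := (h b hb).injOn_Ico
  disjoint_bot _ hne := (hne rfl).elim
  disjoint_top ha' _ := (Finset.notMem_erase _ _ ha').elim

theorem RVStep.exists_hasTowers {w l : Option ι} (hs : S.RVStep w l S') (h : S.HasBranches)
    (hT : S.HasTowers F X n) : ∃ n', S'.HasTowers F X n' := by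
  cases hs with
  | top_wins _ _ ha hb hab hr hl =>
    exact ⟨_, (h.isStacking_topWins ha.1 hb.1 hab hr hl.le).hasTowers hT⟩
  | bot_wins _ _ ha hb hab hr hl =>
    exact ⟨_, (h.isStacking_botWins ha.1 hb.1 hab hr hl.le).hasTowers hT⟩
  | none_wins _ _ ha hb hab hr hl =>
    exact ⟨_, (h.isStacking_noneWins ha.1 hb.1 hab hr hl).hasTowers hT⟩
  | top_wins_gap _ _ _ _ hr => exact ⟨_, hT.cutTop hr.le⟩
  | bot_wins_gap _ b _ hb hr hl => exact ⟨_, hT.cutBot ((h b hb.1).mapsTo_inv ⟨hl.le, hr.le⟩).2⟩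
  | bot_gap_wins => exact ⟨_, hT.restrict (Finset.erase_subset _ _)⟩
  | top_gap_wins => exact ⟨_, hT.restrict (Finset.erase_subset _ _)⟩

end Stacking

end Towers

end GapMap

/-! ### The renormalization scheme -/

theorem eventually_forall_ge_not_or_frequently (p : ℕ → Prop) :
    ∀ᶠ N in atTop, (∀ n ≥ N, ¬ p n) ∨ ∃ᶠ n in atTop, p n := by
  by_cases h : ∃ᶠ n in atTop, p n
  · exact .of_forall fun _ => .inr h
  · exact (eventually_forall_ge_atTop.2 (not_frequently.1 h)).mono fun _ => .inl

theorem natCard_get_eq_sum {β : Type*} (P : β → Prop) [DecidablePred P] (L : List β) :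
    Nat.card {i : Fin L.length // P (L.get i)} = (L.map fun R => if P R then 1 else 0).sum := by
  rw [Nat.card_eq_fintype_card, Fintype.card_subtype, Finset.card_filter]
  exact Fin.sum_univ_fun_getElem L fun R => if P R then 1 else 0

namespace GapMap

section Renormalization

variable {ι : Type*} [DecidableEq ι] {S S' : GapMap ι} {L : List (GapMap ι)}

section Induction

variable {s : ℕ → GapMap ι} {w l : ℕ → Option ι} {w₀ l₀ : Option ι} {N : ℕ}

theorem RVStep.letters_subset (h : S.RVStep w₀ l₀ S') : S'.letters ⊆ S.letters := by
  cases h <;> first | exact Subset.rfl | exact Finset.erase_subset _ _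

theorem RVReach.letters_subset (h : RVReach S S') : S'.letters ⊆ S.letters := by
  induction h with
  | refl => exact Subset.rfl
  | tail _ hstep ih =>
    obtain ⟨_, _, hstep⟩ := hstep
    exact hstep.letters_subset.trans ih

theorem RVStep.exists_winner (h : S.RVStep w₀ l₀ S') (hL : S'.letters = S.letters) :
    ∃ α ∈ S.letters, w₀ = some α := by
  cases h with
  | top_wins a _ ha => exact ⟨a, ha.1, rfl⟩
  | bot_wins _ b _ hb => exact ⟨b, hb.1, rfl⟩
  | none_wins a _ ha => exact (Finset.notMem_erase a S.letters (hL.symm.subset ha.1)).elim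
  | top_wins_gap a _ ha => exact ⟨a, ha.1, rfl⟩
  | bot_wins_gap _ b _ hb => exact ⟨b, hb.1, rfl⟩
  | bot_gap_wins a _ ha => exact (Finset.notMem_erase a S.letters (hL.symm.subset ha.1)).elim
  | top_gap_wins _ b _ hb => exact (Finset.notMem_erase b S.letters (hL.symm.subset hb.1)).elim

theorem exists_rvStep (hne : S.letters.Nonempty) (hc : ∀ a, ¬ S.IsCylinder a) :
    ∃ w l S', S.RVStep w l S' := by
  obtain ⟨a, ha⟩ : ∃ a, S.IsTopLast a := S.letters.exists_max_image S.tr hne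
  obtain ⟨b, hb⟩ : ∃ b, S.IsBotLast b := S.letters.exists_max_image S.br hne
  rcases lt_trichotomy (S.tr a) (S.br b) with hr | hr | hr
  · rcases lt_or_ge (S.bl b) (S.tr a) with hl | hl
    · exact ⟨_, _, _, .bot_wins_gap a b ha hb hr hl⟩
    · exact ⟨_, _, _, .top_gap_wins a b ha hb hr hl⟩
  · have hab : a ≠ b := by
      rintro rfl
      exact hc a ⟨ha, hb, hr⟩
    rcases lt_trichotomy (S.tl a) (S.bl b) with hl | hl | hl
    · exact ⟨_, _, _, .top_wins a b ha hb hab hr hl⟩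
    · exact ⟨_, _, _, .none_wins a b ha hb hab hr hl⟩
    · exact ⟨_, _, _, .bot_wins a b ha hb hab hr hl⟩
  · rcases lt_or_ge (S.tl a) (S.br b) with hl | hl
    · exact ⟨_, _, _, .top_wins_gap a b ha hb hr hl⟩
    · exact ⟨_, _, _, .bot_gap_wins a b ha hb hr hl⟩

theorem exists_isRVOrbit (h : ∀ S', RVReach S S' → ∃ w l S'', S'.RVStep w l S'') :
    ∃ s w l, s 0 = S ∧ IsRVOrbit s w l := by
  choose w l next hnext using h
  let t : ℕ → {S' // RVReach S S'} := fun n =>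
    Nat.rec ⟨S, .refl⟩ (fun _ S' => ⟨next S'.1 S'.2, S'.2.tail ⟨_, _, hnext S'.1 S'.2⟩⟩) n
  exact ⟨fun n => (t n).1, fun n => w _ (t n).2, fun n => l _ (t n).2, rfl,
    fun n => hnext _ (t n).2⟩

theorem exists_letters_eq_empty_or_isCylinder_or_isRVOrbit (S : GapMap ι) :
    (∃ S', RVReach S S' ∧ S'.letters = ∅) ∨ (∃ S' a, RVReach S S' ∧ S'.IsCylinder a) ∨
      ∃ s w l, s 0 = S ∧ IsRVOrbit s w l := by
  by_cases h0 : ∃ S', RVReach S S' ∧ S'.letters = ∅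
  · exact .inl h0
  by_cases hc : ∃ S' a, RVReach S S' ∧ S'.IsCylinder a
  · exact .inr (.inl hc)
  push Not at h0 hc
  exact .inr (.inr (exists_isRVOrbit fun S' h => exists_rvStep (h0 S' h) fun a => hc S' a h))

theorem IsRVOrbit.rvReach (hs : IsRVOrbit s w l) (n : ℕ) : RVReach (s 0) (s n) := by
  induction n with
  | zero => exact .refl
  | succ n ih => exact ih.tail ⟨_, _, hs n⟩

theorem IsRVOrbit.antitone_letters (hs : IsRVOrbit s w l) : Antitone fun n => (s n).letters :=
  antitone_nat_of_succ_le fun n => (hs n).letters_subset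

theorem IsRVOrbit.exists_isRVStable (hs : IsRVOrbit s w l) : ∃ N, IsRVStable s w l N := by
  obtain ⟨M, hM⟩ := WellFoundedLT.antitone_chain_condition hs.antitone_letters
  have hev : ∀ᶠ N in atTop, ∀ α ∈ (s M).letters,
      ((∀ n ≥ N, w n ≠ some α) ∨ ∃ᶠ n in atTop, w n = some α) ∧
      ((∀ n ≥ N, l n ≠ some α) ∨ ∃ᶠ n in atTop, l n = some α) :=
    (Finset.eventually_all _).2 fun α _ =>
      (eventually_forall_ge_not_or_frequently fun n => w n = some α).and
        (eventually_forall_ge_not_or_frequently fun n => l n = some α)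
  obtain ⟨N, hN, hMN⟩ := (hev.and (eventually_ge_atTop M)).exists
  exact ⟨N, fun n hn => (hM n (hMN.trans hn)).symm.trans (hM N hMN),
    fun α hα => hN α ((hM N hMN).symm ▸ hα)⟩

theorem IsRVOrbit.exists_frequently_winner (hs : IsRVOrbit s w l) (hN : IsRVStable s w l N) :
    ∃ α ∈ (s N).letters, ∃ᶠ n in atTop, w n = some α := by
  by_contra! hcon
  have hev : ∀ᶠ n in atTop, ∀ α ∈ (s N).letters, w n ≠ some α :=
    (Finset.eventually_all _).2 fun α hα => hcon α hα
  obtain ⟨n, hn, hNn⟩ := (hev.and (eventually_ge_atTop N)).exists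
  obtain ⟨α, hα, hw⟩ := (hs n).exists_winner
    ((hN.1 (n + 1) (hNn.trans n.le_succ)).trans (hN.1 n hNn).symm)
  exact hn α (hN.1 n hNn ▸ hα) hw

end Induction

theorem exists_scheme (S : GapMap ι) : ∃ L, Scheme S L := by
  induction hd : S.letters.card using Nat.strong_induction_on generalizing S with
  | _ d ih =>
    rcases S.exists_letters_eq_empty_or_isCylinder_or_isRVOrbit with
      ⟨S', h, h0⟩ | ⟨S', a, h, ha⟩ | ⟨s, w, l, rfl, hs⟩
    · exact ⟨_, .trivial S S' h h0⟩
    · have hlt : (S'.letters.erase a).card < d := hd ▸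
        (Finset.card_erase_lt_of_mem ha.1.1).trans_le (Finset.card_le_card h.letters_subset)
      obtain ⟨L, hL⟩ := ih _ hlt (S'.restrict (S'.letters.erase a)) rfl
      exact ⟨_, .cylinder S S' a L h ha hL⟩
    · classical
      obtain ⟨N, hN⟩ := hs.exists_isRVStable
      let E := (s N).letters.filter fun α => ∃ᶠ n in atTop, w n = some α
      have hE : ∀ α, α ∈ E ↔ α ∈ (s N).letters ∧ ∃ᶠ n in atTop, w n = some α := fun α =>
        Finset.mem_filter
      by_cases hlim : Tendsto (fun n => (s n).topEnd) atTop (𝓝 0)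
      · exact ⟨_, .finish s w l N E hs hN hE hlim⟩
      · obtain ⟨α, hα, hw⟩ := hs.exists_frequently_winner hN
        have hssub : (s N).letters \ E ⊂ (s N).letters :=
          Finset.sdiff_ssubset (Finset.filter_subset _ _) ⟨α, (hE α).2 ⟨hα, hw⟩⟩
        have hlt : ((s N).letters \ E).card < d := hd ▸
          (Finset.card_lt_card hssub).trans_le (Finset.card_le_card (hs.rvReach N).letters_subset)
        obtain ⟨L, hL⟩ := ih _ hlt ((s N).restrict ((s N).letters \ E)) rfl
        exact ⟨_, .restart s w l N E L hs hN hE hlim hL⟩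

theorem Scheme.sum_card_letters_le (h : Scheme S L) :
    (L.map fun B => B.letters.card).sum ≤ S.letters.card := by
  induction h with
  | trivial => exact Nat.zero_le _
  | cylinder S S' a L h ha _ ih =>
    have herase := Finset.card_erase_add_one ha.1.1
    have hle := Finset.card_le_card h.letters_subset
    simp only [restrict, List.map_cons, List.sum_cons, Finset.card_singleton] at ih ⊢
    omega
  | finish s w l N E hs _ hE _ =>
    have hsub : E ⊆ (s N).letters := fun α hα => ((hE α).1 hα).1
    simpa [restrict] using Finset.card_le_card (hsub.trans (hs.rvReach N).letters_subset)
  | restart s w l N E L hs _ hE _ _ ih =>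
    have hsub : E ⊆ (s N).letters := fun α hα => ((hE α).1 hα).1
    have hsdiff := Finset.card_sdiff_add_card_eq_card hsub
    have hle := Finset.card_le_card (hs.rvReach N).letters_subset
    simp only [restrict, List.map_cons, List.sum_cons] at ih ⊢
    omega

/-- A property of maps that passes to the successors under the induction and to restrictions, hence
to all outputs of the scheme. -/
structure IsRVInvariant (P : GapMap ι → Prop) : Prop where
  rvStep : ∀ {S S' : GapMap ι} {w l : Option ι}, S.RVStep w l S' → P S → P S'
  restrict : ∀ {S : GapMap ι} {E : Finset ι}, E ⊆ S.letters → P S → P (S.restrict E)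

namespace IsRVInvariant

variable {P : GapMap ι → Prop}

theorem rvReach (hP : IsRVInvariant P) (h : RVReach S S') (hS : P S) : P S' := by
  induction h with
  | refl => exact hS
  | tail _ hstep ih =>
    obtain ⟨_, _, hstep⟩ := hstep
    exact hP.rvStep hstep ih

theorem scheme (hP : IsRVInvariant P) (h : Scheme S L) (hS : P S) : ∀ B ∈ L, P B := by
  induction h with
  | trivial => exact List.forall_mem_nil _
  | cylinder S S' a L h ha _ ih =>
    have hS' := hP.rvReach h hS
    exact List.forall_mem_cons.2
      ⟨hP.restrict (Finset.singleton_subset_iff.2 ha.1.1) hS',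
        ih (hP.restrict (Finset.erase_subset _ _) hS')⟩
  | finish s w l N E hs _ hE _ =>
    exact List.forall_mem_singleton.2
      (hP.restrict (fun α hα => ((hE α).1 hα).1) (hP.rvReach (hs.rvReach N) hS))
  | restart s w l N E L hs _ hE _ _ ih =>
    have hN := hP.rvReach (hs.rvReach N) hS
    exact List.forall_mem_cons.2
      ⟨hP.restrict (fun α hα => ((hE α).1 hα).1) hN, ih (hP.restrict Finset.sdiff_subset hN)⟩

end IsRVInvariant

theorem isRVInvariant_hasBranches : IsRVInvariant (HasBranches : GapMap ι → Prop) where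
  rvStep hs h := hs.hasBranches h
  restrict hE h := h.restrict hE

theorem isRVInvariant_hasBranches_and_hasTowers (F : ℝ → ℝ) (X : Set ℝ) :
    IsRVInvariant fun S : GapMap ι => S.HasBranches ∧ ∃ n, S.HasTowers F X n where
  rvStep := fun hs ⟨h, _, hn⟩ => ⟨hs.hasBranches h, hs.exists_hasTowers h hn⟩
  restrict := fun hE ⟨h, n, hn⟩ => ⟨h.restrict hE, n, hn.restrict hE⟩

theorem IsGGIET.exists_isDecomposition {r : ℕ∞} {T : GapMap ι} (hT : T.IsGGIET r) :
    ∃ L, T.IsDecomposition L := by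
  obtain ⟨Bs, hBs⟩ := exists_scheme T
  have htowers := (isRVInvariant_hasBranches_and_hasTowers T.toFun T.topSet).scheme hBs
    ⟨hT.hasBranches, _, hT.hasTowers⟩
  choose! n hn using fun B hB => (htowers B hB).2
  refine ⟨Bs.map fun B => rep T B (n B), Bs, hBs, ?_⟩
  rw [List.forall₂_map_right_iff, List.forall₂_same]
  exact fun B hB => ⟨n B, (hn B hB).isTowerRep, rfl⟩

end Renormalization

/-! ### The letters needed by periodic and quasiminimal domains -/

section Domains

variable {ι : Type*} {T B : GapMap ι} {R : Set ℝ} {n : ι → ℕ} {α : ι}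

theorem IsPeriodicDomain.nonempty (hp : T.IsPeriodicDomain R) : R.Nonempty := by
  rcases hp.2.1 with ⟨x, hx, -⟩ | ⟨x, ⟨y, hy, hsub⟩, -⟩
  · exact ⟨x, hx⟩
  · exact (nonempty_Ioo.2 hy).mono hsub

theorem IsPeriodicDomain.not_isQuasiminimalDomain (hp : T.IsPeriodicDomain R) :
    ¬ T.IsQuasiminimalDomain R := by
  rintro ⟨-, ⟨Ω, ⟨x, hx, hrec, -⟩, -⟩, -⟩
  obtain ⟨-, -, m, hm⟩ := hp
  exact hrec.infinite_fwdOrbit (.inl PartialDyn.self_mem_fwdOrbit)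
    ((hm x hx (.inr hrec)).1.2.subset subset_union_left)

theorem rep_eq_tower (hB : B.letters = {α}) :
    rep T B n = PartialDyn.tower T.toFun (B.topInterval α) (n α) := by
  simp only [rep, hB, Finset.mem_singleton, iUnion_iUnion_eq_left, PartialDyn.tower]

theorem letters_nonempty_of_rep_nonempty (h : (rep T B n).Nonempty) : B.letters.Nonempty := by
  obtain ⟨x, hx⟩ := h
  obtain ⟨α, hα, -⟩ := mem_iUnion₂.1 hx
  exact ⟨α, hα⟩

theorem IsTowerRep.isTower (h : IsTowerRep T B n) (hα : α ∈ B.letters)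
    (hinj : InjOn T.toFun T.topSet) :
    PartialDyn.IsTower T.toFun (B.topInterval α) (n α) := by
  obtain ⟨hpos, hsub, hdisj, -⟩ := h α hα
  refine ⟨hpos, fun i hi j hj => hdisj i hi j hj, hinj.mono (iUnion₂_subset fun i hi => ?_)⟩
  exact hsub i (Finset.mem_range.1 hi)

theorem IsTowerRep.two_le_card_letters (h : IsTowerRep T B n) (hinj : InjOn T.toFun T.topSet)
    (hB : B.HasBranches) (hq : T.IsQuasiminimalDomain (rep T B n)) : 2 ≤ B.letters.card := by
  obtain ⟨-, ⟨Ω, ⟨x, hx, hrec, -⟩, -⟩, -⟩ := hq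
  have hpos := (letters_nonempty_of_rep_nonempty ⟨x, hx⟩).card_pos
  by_contra hlt
  obtain ⟨α, hα⟩ := Finset.card_eq_one.1 (show B.letters.card = 1 by omega)
  have hmem : α ∈ B.letters := hα ▸ Finset.mem_singleton_self α
  have hmono : MonotoneOn T.toFun^[n α] (B.topInterval α) :=
    ((hB α hmem).strictMonoOn.monotoneOn.mono Ico_subset_Icc_self).congr (h α hmem).2.2.2
  rw [rep_eq_tower hα] at hx hrec
  exact (h.isTower hmem hinj).not_isNontriviallyRecurrent hmono hx hrec

open Classical in
theorem IsTowerRep.weight_le_card_letters (h : IsTowerRep T B n) (hinj : InjOn T.toFun T.topSet)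
    (hB : B.HasBranches) :
    2 * (if T.IsQuasiminimalDomain (rep T B n) then 1 else 0) +
      (if T.IsPeriodicDomain (rep T B n) then 1 else 0) ≤ B.letters.card := by
  split_ifs with hq hp hp
  · exact (hp.not_isQuasiminimalDomain hq).elim
  · exact h.two_le_card_letters hinj hB hq
  · exact (letters_nonempty_of_rep_nonempty hp.nonempty).card_pos
  · exact Nat.zero_le _

end Domains

theorem HasBranches.two_mul_numQuasiminimal_add_numPeriodic_le {ι : Type*} [DecidableEq ι]
    {T : GapMap ι} {L : List (Set ℝ)} (hT : T.HasBranches) (hinj : InjOn T.toFun T.topSet)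
    (hL : T.IsDecomposition L) :
    2 * T.numQuasiminimal L + T.numPeriodic L ≤ T.letters.card := by
  classical
  obtain ⟨Bs, hBs, hrep⟩ := hL
  have hbranches := isRVInvariant_hasBranches.scheme hBs hT
  refine le_trans ?_ hBs.sum_card_letters_le
  rw [numQuasiminimal, numPeriodic, natCard_get_eq_sum, natCard_get_eq_sum,
    ← List.sum_map_mul_left, ← List.sum_map_add]
  refine List.Forall₂.sum_le_sum ?_
  rw [List.forall₂_map_left_iff, List.forall₂_map_right_iff]
  refine List.Forall₂.flip (((List.forall₂_and_left _ _).2 ⟨hbranches, hrep⟩).imp ?_)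
  rintro B _ ⟨hB, n, hn, rfl⟩
  exact hn.weight_le_card_letters hinj hB

end GapMap

theorem theorem1p3_general {ι : Type*} [DecidableEq ι] (r : ℕ∞) (T : GapMap ι)
    (hT : T.IsGGIET r) :
    (∃ L : List (Set ℝ), T.IsDecomposition L) ∧
      ∀ L : List (Set ℝ), T.IsDecomposition L →
        (T.numQuasiminimal L : ℤ) ≤ ⌊((T.letters.card : ℝ) - (T.numPeriodic L : ℝ)) / 2⌋ := by
  refine ⟨hT.exists_isDecomposition, fun L hL => Int.le_floor.2 ?_⟩
  have hle : (2 * T.numQuasiminimal L + T.numPeriodic L : ℝ) ≤ T.letters.card := by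
    exact_mod_cast hT.hasBranches.two_mul_numQuasiminimal_add_numPeriodic_le hT.injOn_toFun hL
  push_cast
  linarith

theorem theorem1p3 {ι : Type*} [DecidableEq ι] (r : ℕ∞) (T : GapMap ι) (hT : T.IsGIET r) :
    (∃ L : List (Set ℝ), T.IsDecomposition L) ∧
      ∀ L : List (Set ℝ), T.IsDecomposition L →
        (T.numQuasiminimal L : ℤ) ≤ ⌊((T.letters.card : ℝ) - (T.numPeriodic L : ℝ)) / 2⌋ :=
  theorem1p3_general r T hT.toIsGGIET
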